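/- Let $A\in\mathbb{R}^{n\times n}$, $B\in\mathbb{R}^{n\times m}$, $C\in\mathbb{R}^{p\times n}$ be lower block triangular with respect to partitions $n=n_1+\cdots+n_N$, $m=m_1+\cdots+m_N$, $p=p_1+\cdots+p_N$, and let $F\in\mathbb{R}^{q\times n}$, $H\in\mathbb{R}^{q\times m}$, $W\in\mathbb{R}^{n\times r}$, $V\in\mathbb{R}^{p\times r}$. For a matrix partitioned in this way, the subscripts $\downarrow i$, $\uparrow i$ select its block rows $i,\dots,N$ and $1,\dots,i$ respectively, and the superscripts $\downarrow i$, $\uparrow i$ select block columns in the same way. Write $(X,K)=ARE_p(A,B,F,H)$ if, with $\Psi=H^TH$, $$A^TX+XA-(XB+F^TH)\Psi^{-1}(XB+F^TH)^T+F^TF=0,\qquad K=-\Psi^{-1}(XB+F^TH)^T;$$ the solution is called stabilizing if $A+BK$ is Hurwitz. Write $(Y,L)=ARE_d(A,C,W,V)$ if, with $\Phi=VV^T$, $$AY+YA^T-(CY+VW^T)^T\Phi^{-1}(CY+VW^T)+WW^T=0,\qquad L=-(CY+VW^T)^T\Phi^{-1};$$ the solution is called stabilizing if $A+LC$ is Hurwitz.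 Assume: (1) $(A_{ii},B_{ii})$ is stabilizable for every $i\in\{1,\dots,N\}$ and $H$ has full column rank; (2) $\begin{bmatrix}A-j\omega I&B\\F&H\end{bmatrix}$ has full column rank for all $\omega\in\mathbb{R}$; (3) $(C_{ii},A_{ii})$ is detectable for every $i\in\{1,\dots,N\}$ and $V$ has full row rank; (4) $\begin{bmatrix}A-j\omega I&W\\C&V\end{bmatrix}$ has full row rank for all $\omega\in\mathbb{R}$. Then: (a) $ARE_p(A,B,F,H)$ has a positive semidefinite stabilizing solution $(\hat X_1,\hat K_1)$, and this is its only symmetric stabilizing solution. Starting from it, for $i=2,\dots,N$ successively, the equation $$(\hat X_i,\hat K_i)=ARE_p\big(A_{\downarrow i}^{\downarrow i},\,B_{\downarrow i}^{\downarrow i},\,-H^{\downarrow i-1}\hat K_{i-1}^b,\,H^{\downarrow i}\big),$$ where $\hat K_{i-1}^b$ is $\hat K_{i-1}$ with its first block column (the one of width $n_{i-1}$) deleted, has a unique positive semidefinite solution $(\hat X_i,\hat K_i)$, and this solution is stabilizing. (b) $ARE_d(A,C,W,V)$ has a positive semidefinite stabilizing solution $(\hat Y_N,\hat L_N)$, and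 this is its only symmetric stabilizing solution. Starting from it, for $i=N-1,\dots,1$ successively, the equation $$(\hat Y_i,\hat L_i)=ARE_d\big(A_{\uparrow i}^{\uparrow i},\,C_{\uparrow i}^{\uparrow i},\,-\hat L_{i+1}^bV_{\uparrow i+1},\,V_{\uparrow i}\big),$$ where $\hat L_{i+1}^b$ is $\hat L_{i+1}$ with its last block row (the one of height $n_{i+1}$) deleted, has a unique positive semidefinite solution $(\hat Y_i,\hat L_i)$, and this solution is stabilizing. -/

import Mathlib

open scoped Matrix

namespace TriangularLQG

section General

variable {n m p q : Type*} [Fintype n] [DecidableEq n] [Fintype m] [DecidableEq m]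
  [Fintype p] [DecidableEq p] [Fintype q] [DecidableEq q]

/-- Entrywise embedding of a real matrix into the complex matrices. -/
def cplx {a b : Type*} (M : Matrix a b ℝ) : Matrix a b ℂ := M.map Complex.ofReal

/-- A real square matrix is Hurwitz stable: all its complex eigenvalues have negative real part. -/
def IsHurwitz (M : Matrix n n ℝ) : Prop :=
  ∀ z ∈ spectrum ℂ (cplx M), z.re < 0

/-- `(A, B)` is stabilizable. -/
def Stabilizable (A : Matrix n n ℝ) (B : Matrix n m ℝ) : Prop :=
  ∃ K : Matrix m n ℝ, IsHurwitz (A + B * K)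

/-- `(C, A)` is detectable. -/
def Detectable (C : Matrix p n ℝ) (A : Matrix n n ℝ) : Prop :=
  ∃ L : Matrix n p ℝ, IsHurwitz (A + L * C)

/-- Full column rank: the columns are linearly independent. -/
def FullColRank {𝕜 a b : Type*} [Field 𝕜] (M : Matrix a b 𝕜) : Prop :=
  LinearIndependent 𝕜 M.col

/-- Full row rank: the rows are linearly independent. -/
def FullRowRank {𝕜 a b : Type*} [Field 𝕜] (M : Matrix a b 𝕜) : Prop :=
  LinearIndependent 𝕜 M.row

/-- The complex matrix `[A - jωI, B; F, H]`. -/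
def pencil (A : Matrix n n ℝ) (B : Matrix n m ℝ) (F : Matrix q n ℝ) (H : Matrix q m ℝ)
    (ω : ℝ) : Matrix (n ⊕ q) (n ⊕ m) ℂ :=
  Matrix.fromBlocks (cplx A - (Complex.I * (ω : ℂ)) • (1 : Matrix n n ℂ)) (cplx B)
    (cplx F) (cplx H)

/-- `(X, K) = ARE_p(A, B, F, H)`: `X` solves the primal (control) algebraic Riccati equation,
with weight `Ψ = HᵀH`, and `K` is the associated gain. -/
def AREp (A : Matrix n n ℝ) (B : Matrix n m ℝ) (F : Matrix q n ℝ) (H : Matrix q m ℝ)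
    (X : Matrix n n ℝ) (K : Matrix m n ℝ) : Prop :=
  Aᵀ * X + X * A - (X * B + Fᵀ * H) * (Hᵀ * H)⁻¹ * (X * B + Fᵀ * H)ᵀ + Fᵀ * F = 0 ∧
    K = -((Hᵀ * H)⁻¹ * (X * B + Fᵀ * H)ᵀ)

/-- `(Y, L) = ARE_d(A, C, W, V)`: `Y` solves the dual (filtering) algebraic Riccati equation,
with weight `Φ = VVᵀ`, and `L` is the associated gain. -/
def AREd (A : Matrix n n ℝ) (C : Matrix p n ℝ) (W : Matrix n q ℝ) (V : Matrix p q ℝ)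
    (Y : Matrix n n ℝ) (L : Matrix n p ℝ) : Prop :=
  A * Y + Y * Aᵀ - (C * Y + V * Wᵀ)ᵀ * (V * Vᵀ)⁻¹ * (C * Y + V * Wᵀ) + W * Wᵀ = 0 ∧
    L = -((C * Y + V * Wᵀ)ᵀ * (V * Vᵀ)⁻¹)

/-- `(X, K)` is a positive semidefinite stabilizing solution of `ARE_p(A, B, F, H)`, and the only
symmetric stabilizing one. -/
def IsTheStabilizingAREp (A : Matrix n n ℝ) (B : Matrix n m ℝ) (F : Matrix q n ℝ)
    (H : Matrix q m ℝ) (X : Matrix n n ℝ) (K : Matrix m n ℝ) : Prop :=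
  AREp A B F H X K ∧ X.PosSemidef ∧ IsHurwitz (A + B * K) ∧
    ∀ (X' : Matrix n n ℝ) (K' : Matrix m n ℝ),
      AREp A B F H X' K' → X'.IsSymm → IsHurwitz (A + B * K') → X' = X ∧ K' = K

/-- `(X, K)` is the unique positive semidefinite solution of `ARE_p(A, B, F, H)`, and it is
stabilizing. -/
def IsUniquePSDAREp (A : Matrix n n ℝ) (B : Matrix n m ℝ) (F : Matrix q n ℝ)
    (H : Matrix q m ℝ) (X : Matrix n n ℝ) (K : Matrix m n ℝ) : Prop :=
  AREp A B F H X K ∧ X.PosSemidef ∧ IsHurwitz (A + B * K) ∧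
    ∀ (X' : Matrix n n ℝ) (K' : Matrix m n ℝ),
      AREp A B F H X' K' → X'.PosSemidef → X' = X ∧ K' = K

/-- `(Y, L)` is a positive semidefinite stabilizing solution of `ARE_d(A, C, W, V)`, and the only
symmetric stabilizing one. -/
def IsTheStabilizingAREd (A : Matrix n n ℝ) (C : Matrix p n ℝ) (W : Matrix n q ℝ)
    (V : Matrix p q ℝ) (Y : Matrix n n ℝ) (L : Matrix n p ℝ) : Prop :=
  AREd A C W V Y L ∧ Y.PosSemidef ∧ IsHurwitz (A + L * C) ∧
    ∀ (Y' : Matrix n n ℝ) (L' : Matrix n p ℝ),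
      AREd A C W V Y' L' → Y'.IsSymm → IsHurwitz (A + L' * C) → Y' = Y ∧ L' = L

/-- `(Y, L)` is the unique positive semidefinite solution of `ARE_d(A, C, W, V)`, and it is
stabilizing. -/
def IsUniquePSDAREd (A : Matrix n n ℝ) (C : Matrix p n ℝ) (W : Matrix n q ℝ)
    (V : Matrix p q ℝ) (Y : Matrix n n ℝ) (L : Matrix n p ℝ) : Prop :=
  AREd A C W V Y L ∧ Y.PosSemidef ∧ IsHurwitz (A + L * C) ∧
    ∀ (Y' : Matrix n n ℝ) (L' : Matrix n p ℝ),
      AREd A C W V Y' L' → Y'.PosSemidef → Y' = Y ∧ L' = L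

end General

section Blocks

variable {N : ℕ}

/-- Index set of a vector partitioned into `N` blocks of sizes `n 0, …, n (N - 1)`. -/
abbrev Idx (n : Fin N → ℕ) : Type := Σ i : Fin N, Fin (n i)

/-- The indices lying in block `i` or a later block (the range `↓i`). -/
abbrev Down (n : Fin N → ℕ) (i : Fin N) : Type := {x : Idx n // i ≤ x.1}

/-- The indices lying in block `i` or an earlier block (the range `↑i`). -/
abbrev Up (n : Fin N → ℕ) (i : Fin N) : Type := {x : Idx n // x.1 ≤ i}

/-- For `i ≤ j` the range `↓j` is contained in `↓i`. -/
def Down.incl {n : Fin N → ℕ} {i j : Fin N} (h : i ≤ j) (x : Down n j) : Down n i :=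
  ⟨x.1, h.trans x.2⟩

/-- For `i ≤ j` the range `↑i` is contained in `↑j`. -/
def Up.incl {n : Fin N → ℕ} {i j : Fin N} (h : i ≤ j) (x : Up n i) : Up n j :=
  ⟨x.1, x.2.trans h⟩

/-- Lower block triangular matrices. -/
def IsLBT {a b : Fin N → ℕ} (M : Matrix (Idx a) (Idx b) ℝ) : Prop :=
  ∀ x y, x.1 < y.1 → M x y = 0

/-- The diagonal block `M_{ii}`. -/
def diagBlock {a b : Fin N → ℕ} (M : Matrix (Idx a) (Idx b) ℝ) (i : Fin N) :
    Matrix (Fin (a i)) (Fin (b i)) ℝ :=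
  M.submatrix (fun k => ⟨i, k⟩) (fun k => ⟨i, k⟩)

/-- The sub-block of `M` with rows and columns in `↓i`. -/
def dd {a b : Fin N → ℕ} (M : Matrix (Idx a) (Idx b) ℝ) (i : Fin N) :
    Matrix (Down a i) (Down b i) ℝ :=
  M.submatrix Subtype.val Subtype.val

/-- The sub-block of `M` with rows and columns in `↑i`. -/
def uu {a b : Fin N → ℕ} (M : Matrix (Idx a) (Idx b) ℝ) (i : Fin N) :
    Matrix (Up a i) (Up b i) ℝ :=
  M.submatrix Subtype.val Subtype.val

/-- The columns `↓i` of `M`. -/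
def downCols {r : Type*} {b : Fin N → ℕ} (M : Matrix r (Idx b) ℝ) (i : Fin N) :
    Matrix r (Down b i) ℝ :=
  M.submatrix id Subtype.val

/-- The rows `↑i` of `M`. -/
def upRows {r : Type*} {a : Fin N → ℕ} (M : Matrix (Idx a) r ℝ) (i : Fin N) :
    Matrix (Up a i) r ℝ :=
  M.submatrix Subtype.val id

/-- For `j` the successor of `i`: the part of a matrix with columns `↓i` obtained by
deleting its first block column (so the columns `↓j` remain). -/
def tailCols {r : Type*} {b : Fin N → ℕ} {i j : Fin N} (h : i ≤ j)
    (K : Matrix r (Down b i) ℝ) : Matrix r (Down b j) ℝ :=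
  K.submatrix id (Down.incl h)

/-- For `j` the successor of `i`: the part of a matrix with rows `↑j` obtained by
deleting its last block row (so the rows `↑i` remain). -/
def headRows {r : Type*} {a : Fin N → ℕ} {i j : Fin N} (h : i ≤ j)
    (L : Matrix (Up a j) r ℝ) : Matrix (Up a i) r ℝ :=
  L.submatrix (Up.incl h) id

theorem le_of_succ {i j : Fin N} (h : (i : ℕ) + 1 = (j : ℕ)) : i ≤ j :=
  Fin.le_def.mpr (by omega)

end Blocks

end TriangularLQG

open TriangularLQG

/-!
# Riccati recursions for block lower triangular systems

*The basic equation.* Write `Ψ = HᵀH`, `K(X) = -Ψ⁻¹(XB + FᵀH)ᵀ`, and for a gain `K` let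
`ℒ_K(X) = (A + BK)ᵀX + X(A + BK) + (F + HK)ᵀ(F + HK)`. Completing the square gives
`ℒ_K(X) = Ric(X) + (K - K(X))ᵀΨ(K - K(X))` for symmetric `X` (`closedLoopLyap_eq`), from which the
monotonicity and comparison arguments below are read off. Starting at a stabilizing gain, Kleinman's
iteration solves `ℒ_{K_k}(X_k) = 0` and puts `K_{k+1} = K(X_k)`: the gains stay stabilizing, the
`X_k ≥ 0` decrease, and their limit solves the Riccati equation with closed-loop spectrum in the
closed left half plane (`exists_ricc_eq_zero`). If `(A + BK)v = zv` for a positive semidefinite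
solution and `Re z ≥ 0`, pairing `ℒ_K(X) = 0` with `v` gives `(F + HK)v = 0`, so `(v, Kv)` lies in
the kernel of the pencil at `z` (`eq_zero_of_pencil`). Hence full column rank on the imaginary axis
makes the limit stabilizing, and full column rank on the closed right half plane makes every
positive semidefinite solution stabilizing. Two symmetric stabilizing solutions dominate each other,
so they agree.

*The recursion.* In the step from block `i` to its successor, vanishing of the output
`-H K^b x + H u` means `u = K^b x`, because `H` is injective. Extended by zero, `x` is then an
eigenvector of the previous closed loop, since the trailing blocks span invariant subspaces. That
closed loop is Hurwitz, so the pencil has full column rank on the whole closed right half plane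
(`exists_isUniquePSDAREp_restrict`), whatever the pencil of the original system does off the axis.

Stabilizability of the whole system and of its trailing parts comes from a block diagonal gain. The
filtering statement is the control statement for the transposed matrices, with the order of the
blocks reversed.

Lyapunov equations are handled without matrix exponentials: the Cayley transform
`M = (1 + A)(1 - A)⁻¹` of a Hurwitz matrix has spectral radius below one, so `M ^ k → 0` by
Gelfand's formula, and `AᵀD + DA + Q = 0` turns into `D = MᵀDM + 2SᵀQS` with `S = (1 - A)⁻¹`.
-/

namespace TriangularLQG

open Filter Topology Matrix

/-! ### Real matrices acting on complex vectors -/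

section Complexification

variable {a b c : Type*}

theorem cplx_add (M N : Matrix a b ℝ) : cplx (M + N) = cplx M + cplx N := by
  ext; simp [cplx]

theorem cplx_neg (M : Matrix a b ℝ) : cplx (-M) = -cplx M := by
  ext; simp [cplx]

theorem cplx_transpose (M : Matrix a b ℝ) : cplx Mᵀ = (cplx M)ᵀ := rfl

theorem cplx_one [DecidableEq a] : cplx (1 : Matrix a a ℝ) = 1 :=
  Matrix.map_one _ Complex.ofReal_zero Complex.ofReal_one

theorem cplx_mul [Fintype b] (M : Matrix a b ℝ) (N : Matrix b c ℝ) :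
    cplx (M * N) = cplx M * cplx N :=
  Matrix.map_mul (f := Complex.ofRealHom)

theorem cplx_pow [Fintype a] [DecidableEq a] (M : Matrix a a ℝ) (k : ℕ) :
    cplx (M ^ k) = cplx M ^ k := by
  induction k with
  | zero => simp [cplx_one]
  | succ k ih => rw [pow_succ, pow_succ, cplx_mul, ih]

theorem cplx_mulVec_ofReal [Fintype b] (M : Matrix a b ℝ) (v : b → ℝ) :
    cplx M *ᵥ (fun i => (v i : ℂ)) = fun i => ((M *ᵥ v) i : ℂ) := by
  ext i; simp [cplx, Matrix.mulVec, dotProduct]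

/-- A left inverse over `ℝ` makes a matrix injective on complex vectors. -/
theorem cplx_mulVec_eq_zero_of_leftInverse [Fintype a] [Fintype b] [DecidableEq b]
    {M : Matrix a b ℝ} {N : Matrix b a ℝ} (h : N * M = 1) {v : b → ℂ}
    (hv : cplx M *ᵥ v = 0) : v = 0 := by
  have h1 : cplx N *ᵥ (cplx M *ᵥ v) = v := by
    rw [Matrix.mulVec_mulVec, ← cplx_mul, h, cplx_one, Matrix.one_mulVec]
  rw [← h1, hv, Matrix.mulVec_zero]

end Complexification

/-! ### Hurwitz matrices and the Cayley transform -/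

section Hurwitz

variable {n n' : Type*} [Fintype n] [DecidableEq n] [Fintype n'] [DecidableEq n']

theorem mem_spectrum_iff_exists_mulVec {M : Matrix n n ℂ} {z : ℂ} :
    z ∈ spectrum ℂ M ↔ ∃ v, v ≠ 0 ∧ M *ᵥ v = z • v := by
  rw [spectrum.mem_iff, Matrix.isUnit_iff_isUnit_det, isUnit_iff_ne_zero, not_not,
    ← Matrix.exists_mulVec_eq_zero_iff]
  refine exists_congr fun v => and_congr_right fun _ => ?_
  rw [Matrix.sub_mulVec, Matrix.algebraMap_eq_diagonal, sub_eq_zero, eq_comm]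
  have : (diagonal (algebraMap ℂ (n → ℂ) z)) *ᵥ v = z • v := by
    ext i; simp [Matrix.mulVec_diagonal]
  rw [this]

/-- A matrix is Hurwitz when no complex eigenvector belongs to the closed right half plane. -/
theorem isHurwitz_iff {M : Matrix n n ℝ} :
    IsHurwitz M ↔ ∀ (z : ℂ) (v : n → ℂ), 0 ≤ z.re → cplx M *ᵥ v = z • v → v = 0 := by
  constructor
  · intro h z v hz hv
    by_contra hne
    exact absurd (h z (mem_spectrum_iff_exists_mulVec.2 ⟨v, hne, hv⟩)) (not_lt.2 hz)
  · intro h z hz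
    obtain ⟨v, hne, hv⟩ := mem_spectrum_iff_exists_mulVec.1 hz
    by_contra hcon
    exact hne (h z v (not_lt.1 hcon) hv)

theorem IsHurwitz.transpose {M : Matrix n n ℝ} (h : IsHurwitz M) : IsHurwitz Mᵀ := by
  intro z hz
  refine h z ?_
  rw [cplx_transpose, Matrix.mem_spectrum_iff_isRoot_charpoly, Matrix.charpoly_transpose] at hz
  exact Matrix.mem_spectrum_iff_isRoot_charpoly.2 hz

theorem isHurwitz_transpose_iff {M : Matrix n n ℝ} : IsHurwitz Mᵀ ↔ IsHurwitz M :=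
  ⟨fun h => by simpa using h.transpose, IsHurwitz.transpose⟩

/-- The restriction of a Hurwitz matrix to an invariant subspace is Hurwitz. -/
theorem IsHurwitz.of_intertwine {M : Matrix n n ℝ} (h : IsHurwitz M) {M' : Matrix n' n' ℝ}
    {E : Matrix n n' ℝ} {E' : Matrix n' n ℝ} (hE : E' * E = 1) (hM : M * E = E * M') :
    IsHurwitz M' := by
  rw [isHurwitz_iff] at h ⊢
  intro z v hz hv
  refine cplx_mulVec_eq_zero_of_leftInverse hE (h z _ hz ?_)
  rw [Matrix.mulVec_mulVec, ← cplx_mul, hM, cplx_mul, ← Matrix.mulVec_mulVec, hv,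
    Matrix.mulVec_smul]

theorem tendsto_pow_of_spectrum_norm_lt_one [Nonempty n] {M : Matrix n n ℂ}
    (h : ∀ z ∈ spectrum ℂ M, ‖z‖ < 1) : Tendsto (fun k : ℕ => M ^ k) atTop (𝓝 0) := by
  let _ : NormedRing (Matrix n n ℂ) := Matrix.linftyOpNormedRing
  let _ : NormedAlgebra ℂ (Matrix n n ℂ) := Matrix.linftyOpNormedAlgebra
  have _ : CompleteSpace (Matrix n n ℂ) := FiniteDimensional.complete ℂ _
  have hr : spectralRadius ℂ M < 1 := by
    have := spectrum.spectralRadius_lt_of_forall_lt M (r := 1) (fun z hz => by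
      have := h z hz
      exact_mod_cast this)
    simpa using this
  obtain ⟨r, hr1, hr2⟩ := ENNReal.lt_iff_exists_nnreal_btwn.1 hr
  have hg := spectrum.pow_nnnorm_pow_one_div_tendsto_nhds_spectralRadius M
  have hr2' : r < 1 := by exact_mod_cast hr2
  refine squeeze_zero_norm' ?_
    (tendsto_pow_atTop_nhds_zero_of_lt_one r.2 (show (r : ℝ) < 1 from hr2'))
  filter_upwards [hg.eventually_lt_const hr1, eventually_gt_atTop 0] with k hk hk0
  have h1 : ((‖M ^ k‖₊ : ENNReal) ^ (1 / k : ℝ)) ^ (k : ℝ) ≤ (r : ENNReal) ^ (k : ℝ) := by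
    gcongr
  rw [← ENNReal.rpow_mul, one_div, inv_mul_cancel₀ (by positivity), ENNReal.rpow_one,
    ENNReal.rpow_natCast] at h1
  exact_mod_cast h1

/-- The map `z ↦ (1 + z)/(1 - z)` takes the left half plane into the unit disc, so the powers of the
Cayley transform `(1 + A)(1 - A)⁻¹` of a Hurwitz matrix tend to zero. -/
theorem IsHurwitz.exists_cayley {A : Matrix n n ℝ} (h : IsHurwitz A) :
    ∃ S : Matrix n n ℝ, (1 - A) * S = 1 ∧
      Tendsto (fun k : ℕ => ((1 + A) * S) ^ k) atTop (𝓝 0) := by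
  have hdet : IsUnit (1 - A).det := by
    rw [isUnit_iff_ne_zero]
    intro h0
    obtain ⟨v, hv, hv0⟩ := Matrix.exists_mulVec_eq_zero_iff.2 h0
    rw [Matrix.sub_mulVec, Matrix.one_mulVec, sub_eq_zero] at hv0
    have := isHurwitz_iff.1 h 1 (fun i => (v i : ℂ)) (by simp)
      (by rw [cplx_mulVec_ofReal, ← hv0, one_smul])
    exact hv (funext fun i => by simpa using congrFun this i)
  refine ⟨(1 - A)⁻¹, Matrix.mul_nonsing_inv _ hdet, ?_⟩
  set S := (1 - A)⁻¹ with hS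
  have hS1 : (1 - A) * S = 1 := Matrix.mul_nonsing_inv _ hdet
  rcases isEmpty_or_nonempty n with hn | hn
  · exact tendsto_const_nhds.congr fun k => Subsingleton.elim _ _
  have hc : Tendsto (fun k : ℕ => cplx ((1 + A) * S) ^ k) atTop (𝓝 0) := by
    refine tendsto_pow_of_spectrum_norm_lt_one fun z hz => ?_
    obtain ⟨v, hv, hvz⟩ := mem_spectrum_iff_exists_mulVec.1 hz
    set w := cplx S *ᵥ v with hw
    have hwv : w - cplx A *ᵥ w = v := by
      have := congrArg (fun T => cplx T *ᵥ v) hS1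
      simpa [cplx_mul, sub_eq_add_neg, cplx_add, cplx_neg, cplx_one, ← Matrix.mulVec_mulVec,
        Matrix.add_mulVec, Matrix.neg_mulVec, ← hw] using this
    have hw1 : w + cplx A *ᵥ w = z • v := by
      rw [← hvz, cplx_mul, ← Matrix.mulVec_mulVec, ← hw, cplx_add, cplx_one, Matrix.add_mulVec,
        Matrix.one_mulVec]
    have hw0 : w ≠ 0 := by
      intro h0
      rw [h0] at hwv
      exact hv (by simpa using hwv.symm)
    have hz1 : z + 1 ≠ 0 := by
      intro h0
      have hz' : z = -1 := by linear_combination h0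
      rw [hz', ← hwv] at hw1
      apply hw0
      ext i
      have := congrFun hw1 i
      simp at this
      simp only [Pi.zero_apply]
      linear_combination this / 2
    by_contra hcon
    refine hw0 (isHurwitz_iff.1 h ((z - 1) / (z + 1)) w ?_ ?_)
    · rw [Complex.div_re, ← add_div]
      refine div_nonneg ?_ (Complex.normSq_nonneg _)
      have : 1 ≤ ‖z‖ ^ 2 := one_le_pow₀ (not_lt.1 hcon)
      rw [← Complex.normSq_eq_norm_sq, Complex.normSq_apply] at this
      simp
      nlinarith
    · ext i
      have h1 := congrFun hw1 i
      rw [← hwv] at h1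
      simp at h1 ⊢
      field_simp
      linear_combination h1
  have hre : Continuous fun T : Matrix n n ℂ => T.map Complex.re :=
    continuous_id.matrix_map Complex.continuous_re
  have := (hre.tendsto 0).comp hc
  simp only [Function.comp_def, ← cplx_pow] at this
  convert this using 2
  · ext; simp [cplx]
  · ext; simp

end Hurwitz

/-! ### Real positive semidefinite matrices -/

section PosSemidef

variable {n b : Type*}

theorem isSymm_of_posSemidef {X : Matrix n n ℝ} (h : X.PosSemidef) : Xᵀ = X := by
  have := h.isHermitian
  rwa [Matrix.IsHermitian, Matrix.conjTranspose_eq_transpose_of_trivial] at this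

theorem posSemidef_of_forall [Fintype n] {X : Matrix n n ℝ} (hs : Xᵀ = X)
    (h : ∀ x, 0 ≤ x ⬝ᵥ (X *ᵥ x)) :
    X.PosSemidef :=
  .of_dotProduct_mulVec_nonneg
    (by rwa [Matrix.IsHermitian, Matrix.conjTranspose_eq_transpose_of_trivial]) (by simpa using h)

theorem posSemidef_gram [Fintype n] [Fintype b] (G : Matrix b n ℝ) : (Gᵀ * G).PosSemidef := by
  simpa [Matrix.conjTranspose_eq_transpose_of_trivial] using
    Matrix.posSemidef_conjTranspose_mul_self G

theorem cplx_gram_form [Fintype n] [Fintype b] (G : Matrix b n ℝ) (v : n → ℂ) :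
    star v ⬝ᵥ (cplx (Gᵀ * G) *ᵥ v) = ((∑ i, ‖(cplx G *ᵥ v) i‖ ^ 2 : ℝ) : ℂ) := by
  have h : (cplx G)ᵀ = (cplx G)ᴴ := by
    ext i j; simp [cplx]
  rw [cplx_mul, cplx_transpose, h, ← Matrix.mulVec_mulVec, Matrix.dotProduct_mulVec,
    ← Matrix.star_mulVec]
  simp [dotProduct, Complex.conj_mul']

theorem eq_of_posSemidef_sub [Fintype n] {X Y : Matrix n n ℝ} (h1 : (X - Y).PosSemidef)
    (h2 : (Y - X).PosSemidef) : X = Y := by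
  open scoped MatrixOrder in
  exact le_antisymm (Matrix.le_iff.2 h2) (Matrix.le_iff.2 h1)

end PosSemidef

/-! ### Lyapunov equations -/

section Lyapunov

variable {n b c : Type*} [Fintype n] [DecidableEq n] [Fintype b] [Fintype c]

/-- An eigenvector of `A` in the closed right half plane is annihilated by the output matrices of
any Lyapunov equation with a positive semidefinite solution: pairing the equation with `v` gives
`2 (Re z) v*Xv + ‖G₁v‖² + ‖G₂v‖² = 0`. -/
theorem mulVec_eq_zero_of_lyapunov {A X : Matrix n n ℝ} {G₁ : Matrix b n ℝ} {G₂ : Matrix c n ℝ}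
    (hX : X.PosSemidef) (h : Aᵀ * X + X * A + G₁ᵀ * G₁ + G₂ᵀ * G₂ = 0)
    {z : ℂ} {v : n → ℂ} (hz : 0 ≤ z.re) (hv : cplx A *ᵥ v = z • v) :
    cplx G₁ *ᵥ v = 0 ∧ cplx G₂ *ᵥ v = 0 := by
  obtain ⟨R, hR⟩ : ∃ R : Matrix n n ℝ, X = Rᵀ * R := by
    open scoped MatrixOrder in
    obtain ⟨R, hR⟩ := CStarAlgebra.nonneg_iff_eq_star_mul_self.1 (Matrix.nonneg_iff_posSemidef.2 hX)
    exact ⟨R, by rw [hR, Matrix.star_eq_conjTranspose,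
      Matrix.conjTranspose_eq_transpose_of_trivial]⟩
  have h1 : star v ⬝ᵥ (cplx (Aᵀ * X) *ᵥ v) = star z * (star v ⬝ᵥ (cplx X *ᵥ v)) := by
    have hA : (cplx A)ᵀ = (cplx A)ᴴ := by ext i j; simp [cplx]
    rw [cplx_mul, cplx_transpose, hA, ← Matrix.mulVec_mulVec, Matrix.dotProduct_mulVec,
      ← Matrix.star_mulVec, hv, star_smul, smul_dotProduct, smul_eq_mul]
  have h2 : star v ⬝ᵥ (cplx (X * A) *ᵥ v) = z * (star v ⬝ᵥ (cplx X *ᵥ v)) := by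
    rw [cplx_mul, ← Matrix.mulVec_mulVec, hv, Matrix.mulVec_smul, dotProduct_smul, smul_eq_mul]
  have h3 := congrArg (fun T => star v ⬝ᵥ (cplx T *ᵥ v)) h
  simp only [cplx_add, Matrix.add_mulVec, dotProduct_add, h1, h2, cplx_gram_form] at h3
  rw [hR, cplx_gram_form] at h3
  have h4 := congrArg Complex.re h3
  simp [cplx] at h4
  have p0 : 0 ≤ ∑ i, ‖((R.map Complex.ofReal) *ᵥ v) i‖ ^ 2 := by positivity
  have p1 : 0 ≤ ∑ i, ‖((G₁.map Complex.ofReal) *ᵥ v) i‖ ^ 2 := by positivity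
  have p2 : 0 ≤ ∑ i, ‖((G₂.map Complex.ofReal) *ᵥ v) i‖ ^ 2 := by positivity
  norm_cast at h4
  have p3 := mul_nonneg hz p0
  have q1 : ∑ i, ‖((G₁.map Complex.ofReal) *ᵥ v) i‖ ^ 2 = 0 := by linarith
  have q2 : ∑ i, ‖((G₂.map Complex.ofReal) *ᵥ v) i‖ ^ 2 = 0 := by linarith
  rw [Finset.sum_eq_zero_iff_of_nonneg (fun _ _ => by positivity)] at q1 q2
  exact ⟨funext fun i => by simpa [cplx] using q1 i (Finset.mem_univ _),
    funext fun i => by simpa [cplx] using q2 i (Finset.mem_univ _)⟩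

/-- The Cayley transform turns a Lyapunov equation into a Stein equation. -/
theorem lyapunov_cayley {A D Q S : Matrix n n ℝ} (hS : (1 - A) * S = 1)
    (h : Aᵀ * D + D * A + Q = 0) :
    D = ((1 + A) * S)ᵀ * D * ((1 + A) * S) + (2 : ℝ) • (Sᵀ * Q * S) := by
  have hS' : Sᵀ * (1 - A)ᵀ = 1 := by rw [← Matrix.transpose_mul, hS, Matrix.transpose_one]
  have hQ : Q = -(Aᵀ * D + D * A) := by rw [eq_neg_iff_add_eq_zero, add_comm, h]
  have h1 : (1 - A)ᵀ * D * (1 - A) = (1 + A)ᵀ * D * (1 + A) + (2 : ℝ) • Q := by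
    rw [hQ]
    simp only [Matrix.transpose_sub, Matrix.transpose_add, Matrix.transpose_one]
    rw [two_smul]
    noncomm_ring
  calc D = (Sᵀ * (1 - A)ᵀ) * D * ((1 - A) * S) := by rw [hS, hS', Matrix.one_mul, Matrix.mul_one]
    _ = Sᵀ * ((1 - A)ᵀ * D * (1 - A)) * S := by simp only [Matrix.mul_assoc]
    _ = _ := by
      rw [h1, Matrix.transpose_mul, Matrix.mul_add, Matrix.add_mul, Matrix.mul_smul,
        Matrix.smul_mul]
      simp only [Matrix.mul_assoc]

/-- For Hurwitz `A`, a symmetric solution of `AᵀD + DA + Q = 0` with `Q ≥ 0` is positive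
semidefinite. -/
theorem IsHurwitz.posSemidef_of_lyapunov {A D Q : Matrix n n ℝ} (hA : IsHurwitz A)
    (hD : Dᵀ = D) (hQ : Q.PosSemidef) (h : Aᵀ * D + D * A + Q = 0) : D.PosSemidef := by
  obtain ⟨S, hS, hlim⟩ := hA.exists_cayley
  have hst := lyapunov_cayley hS h
  set M := (1 + A) * S with hM
  refine posSemidef_of_forall hD fun x => ?_
  set f : ℕ → ℝ := fun k => ((M ^ k) *ᵥ x) ⬝ᵥ (D *ᵥ ((M ^ k) *ᵥ x)) with hf
  have hanti : Antitone f := by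
    refine antitone_nat_of_succ_le fun k => ?_
    simp only [hf, pow_succ', ← Matrix.mulVec_mulVec]
    set y := (M ^ k) *ᵥ x
    have e1 : y ⬝ᵥ (D *ᵥ y) = (M *ᵥ y) ⬝ᵥ (D *ᵥ (M *ᵥ y))
        + 2 * ((S *ᵥ y) ⬝ᵥ (Q *ᵥ (S *ᵥ y))) := by
      conv_lhs => rw [hst]
      rw [Matrix.add_mulVec, dotProduct_add, Matrix.smul_mulVec, dotProduct_smul, smul_eq_mul]
      simp only [← Matrix.mulVec_mulVec, Matrix.dotProduct_mulVec y, Matrix.vecMul_transpose]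
    have e2 : 0 ≤ (S *ᵥ y) ⬝ᵥ (Q *ᵥ (S *ᵥ y)) := by
      simpa using hQ.dotProduct_mulVec_nonneg (S *ᵥ y)
    linarith
  have hcont : Continuous fun T : Matrix n n ℝ => (T *ᵥ x) ⬝ᵥ (D *ᵥ (T *ᵥ x)) := by fun_prop
  have hlim' : Tendsto f atTop (𝓝 0) := by
    simpa [hf, Function.comp_def] using (hcont.tendsto 0).comp hlim
  simpa [hf] using hanti.le_of_tendsto hlim' 0

theorem IsHurwitz.eq_zero_of_lyapunov {A D : Matrix n n ℝ} (hA : IsHurwitz A)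
    (h : Aᵀ * D + D * A = 0) : D = 0 := by
  obtain ⟨S, hS, hlim⟩ := hA.exists_cayley
  have hst := lyapunov_cayley (Q := 0) hS (by simpa using h)
  set M := (1 + A) * S with hM
  simp only [Matrix.mul_zero, Matrix.zero_mul, smul_zero, add_zero] at hst
  have hk : ∀ k : ℕ, D = (M ^ k)ᵀ * D * M ^ k := by
    intro k
    induction k with
    | zero => simp
    | succ k ih =>
      rw [pow_succ, Matrix.transpose_mul]
      calc D = Mᵀ * D * M := hst
        _ = Mᵀ * ((M ^ k)ᵀ * D * M ^ k) * M := by rw [← ih]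
        _ = _ := by simp only [Matrix.mul_assoc]
  have hcont : Continuous fun T : Matrix n n ℝ => Tᵀ * D * T := by fun_prop
  have h2 := (hcont.tendsto 0).comp hlim
  simp only [Function.comp_def, ← hk, Matrix.mul_zero] at h2
  exact tendsto_nhds_unique tendsto_const_nhds h2

theorem IsHurwitz.exists_lyapunov {A Q : Matrix n n ℝ} (hA : IsHurwitz A) (hQ : Q.PosSemidef) :
    ∃ X : Matrix n n ℝ, X.PosSemidef ∧ Aᵀ * X + X * A + Q = 0 := by
  let L : Matrix n n ℝ →ₗ[ℝ] Matrix n n ℝ :=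
    LinearMap.mulLeft ℝ Aᵀ + LinearMap.mulRight ℝ A
  have hL : ∀ D, L D = Aᵀ * D + D * A := fun D => by simp [L]
  have hinj : Function.Injective L := by
    rw [injective_iff_map_eq_zero]
    intro D hD
    exact hA.eq_zero_of_lyapunov ((hL D).symm.trans hD)
  obtain ⟨X, hX⟩ := (LinearMap.injective_iff_surjective.1 hinj) (-Q)
  have hX' : Aᵀ * X + X * A + Q = 0 := by rw [← hL, hX, neg_add_cancel]
  refine ⟨X, hA.posSemidef_of_lyapunov ?_ hQ hX', hX'⟩
  apply hinj
  rw [hX, hL]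
  have := congrArg Matrix.transpose hX'
  simp only [Matrix.transpose_add, Matrix.transpose_mul, Matrix.transpose_transpose,
    Matrix.transpose_zero, isSymm_of_posSemidef hQ] at this
  rw [eq_neg_iff_add_eq_zero, ← this]
  abel

end Lyapunov

/-! ### Monotone limits, and limits of Hurwitz matrices -/

section Limits

variable {n : Type*} [Fintype n] [DecidableEq n]

/-- A decreasing sequence of positive semidefinite matrices converges. -/
theorem exists_tendsto_of_posSemidef_sub {X : ℕ → Matrix n n ℝ} (h0 : ∀ k, (X k).PosSemidef)
    (h1 : ∀ k, (X k - X (k + 1)).PosSemidef) :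
    ∃ Y : Matrix n n ℝ, Y.PosSemidef ∧ Tendsto X atTop (𝓝 Y) := by
  have hq : ∀ x : n → ℝ, ∃ l, Tendsto (fun k => x ⬝ᵥ (X k *ᵥ x)) atTop (𝓝 l) := by
    intro x
    refine ⟨_, tendsto_atTop_ciInf (antitone_nat_of_succ_le fun k => ?_) ⟨0, ?_⟩⟩
    · have := (h1 k).dotProduct_mulVec_nonneg x
      simpa [Matrix.sub_mulVec] using this
    · rintro _ ⟨k, rfl⟩
      simpa using (h0 k).dotProduct_mulVec_nonneg x
  choose l hl using hq
  -- Polarization recovers the entries from the quadratic forms.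
  have hpol : ∀ k i j, X k i j = ((Pi.single i 1 + Pi.single j 1) ⬝ᵥ
      (X k *ᵥ (Pi.single i 1 + Pi.single j 1)) - Pi.single i 1 ⬝ᵥ (X k *ᵥ Pi.single i 1)
      - Pi.single j 1 ⬝ᵥ (X k *ᵥ Pi.single j 1)) / 2 := by
    intro k i j
    have hs : X k j i = X k i j := congrFun (congrFun (isSymm_of_posSemidef (h0 k)) i) j
    simp [Matrix.mulVec_add, add_dotProduct, hs]
    ring
  have hX : Tendsto X atTop (𝓝 (Matrix.of fun i j => (l (Pi.single i 1 + Pi.single j 1)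
      - l (Pi.single i 1) - l (Pi.single j 1)) / 2)) := by
    refine tendsto_pi_nhds.2 fun i => tendsto_pi_nhds.2 fun j => ?_
    simp only [hpol _ i j]
    exact (((hl _).sub (hl _)).sub (hl _)).div_const 2
  refine ⟨_, posSemidef_of_forall ?_ fun x => ?_, hX⟩
  · ext i j
    simp only [Matrix.transpose_apply, Matrix.of_apply]
    rw [add_comm (Pi.single j 1 : n → ℝ)]
    ring
  · have hc : Continuous fun T : Matrix n n ℝ => x ⬝ᵥ (T *ᵥ x) := by fun_prop
    refine ge_of_tendsto' ((hc.tendsto _).comp hX) fun k => ?_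
    simpa using (h0 k).dotProduct_mulVec_nonneg x

/-- The determinant is the product of the `z - w` over the eigenvalues `w`, and `‖z - w‖ ≥ Re z`
when `Re w < 0`. -/
theorem IsHurwitz.pow_re_le_norm_det {M : Matrix n n ℝ} (h : IsHurwitz M) {z : ℂ}
    (hz : 0 ≤ z.re) : z.re ^ Fintype.card n ≤ ‖(z • (1 : Matrix n n ℂ) - cplx M).det‖ := by
  have hsp := IsAlgClosed.splits (cplx M).charpoly
  have h1 : (z • (1 : Matrix n n ℂ) - cplx M).det = (cplx M).charpoly.eval z := by
    rw [Matrix.eval_charpoly, Matrix.smul_one_eq_diagonal]; rfl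
  rw [h1, hsp.eval_eq_prod_roots_of_monic (Matrix.charpoly_monic _)]
  have hcard : Fintype.card n = ((cplx M).charpoly.roots).card := by
    rw [← hsp.natDegree_eq_card_roots, Matrix.charpoly_natDegree_eq_dim]
  rw [hcard, ← Multiset.prod_replicate, ← Multiset.map_const']
  have : ‖((cplx M).charpoly.roots.map (fun a => z - a)).prod‖
      = ((cplx M).charpoly.roots.map (fun a => ‖z - a‖)).prod := by
    simpa using map_multiset_prod (normHom : ℂ →*₀ ℝ)
      ((cplx M).charpoly.roots.map (fun a => z - a))
  rw [this]
  refine Multiset.prod_map_le_prod_map₀ _ _ (fun _ _ => hz) fun w hw => ?_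
  have hw' : w.re < 0 := h w
    (Matrix.mem_spectrum_iff_isRoot_charpoly.2 (Polynomial.isRoot_of_mem_roots hw))
  calc z.re ≤ (z - w).re := by simp [hw'.le]
    _ ≤ ‖z - w‖ := Complex.re_le_norm _

/-- A limit of Hurwitz matrices has no eigenvalue in the open right half plane: at such a point
the characteristic polynomials stay bounded away from zero. -/
theorem eq_zero_of_tendsto_hurwitz {M : ℕ → Matrix n n ℝ} {M' : Matrix n n ℝ}
    (hM : ∀ k, IsHurwitz (M k)) (hlim : Tendsto M atTop (𝓝 M')) {z : ℂ} (hz : 0 < z.re)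
    {v : n → ℂ} (hv : cplx M' *ᵥ v = z • v) : v = 0 := by
  by_contra hne
  have hdet : (z • (1 : Matrix n n ℂ) - cplx M').det = 0 :=
    Matrix.exists_mulVec_eq_zero_iff.1 ⟨v, hne, by
      rw [Matrix.sub_mulVec, Matrix.smul_mulVec, Matrix.one_mulVec, hv, sub_self]⟩
  have hc : Continuous fun T : Matrix n n ℝ => ‖(z • (1 : Matrix n n ℂ) - cplx T).det‖ := by
    have : Continuous fun T : Matrix n n ℝ => cplx T :=
      continuous_id.matrix_map Complex.continuous_ofReal
    fun_prop
  have := ge_of_tendsto' ((hc.tendsto M').comp hlim) fun k => (hM k).pow_re_le_norm_det hz.le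
  rw [hdet, norm_zero] at this
  exact absurd this (not_le.2 (pow_pos hz _))

end Limits

/-! ### The Riccati equation and policy iteration -/

section Riccati

variable {n m q : Type*} [Fintype n] [Fintype m] [Fintype q]

/-- The left-hand side of the Lyapunov equation satisfied by the cost matrix `X` of the fixed
feedback `u = Kx`. -/
def closedLoopLyap (A : Matrix n n ℝ) (B : Matrix n m ℝ) (F : Matrix q n ℝ) (H : Matrix q m ℝ)
    (K : Matrix m n ℝ) (X : Matrix n n ℝ) : Matrix n n ℝ :=
  (A + B * K)ᵀ * X + X * (A + B * K) + (F + H * K)ᵀ * (F + H * K)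

variable {A : Matrix n n ℝ} {B : Matrix n m ℝ} {F : Matrix q n ℝ} {H : Matrix q m ℝ}

theorem closedLoopLyap_sub (K : Matrix m n ℝ) (X X' : Matrix n n ℝ) :
    closedLoopLyap A B F H K X - closedLoopLyap A B F H K X'
      = (A + B * K)ᵀ * (X - X') + (X - X') * (A + B * K) := by
  simp only [closedLoopLyap, Matrix.mul_sub, Matrix.sub_mul]
  abel

/-- Comparison: if `X'` is the cost of the stabilizing gain `K'`, then every symmetric supersolution
of its Lyapunov equation, that is `X` with `closedLoopLyap K' X ≤ 0`, dominates `X'`. -/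
theorem posSemidef_sub_of_closedLoopLyap [DecidableEq n] {K' : Matrix m n ℝ}
    (hK' : IsHurwitz (A + B * K'))
    {X X' : Matrix n n ℝ} (hX : Xᵀ = X) (hX' : X'ᵀ = X')
    (h' : closedLoopLyap A B F H K' X' = 0)
    (h : (-closedLoopLyap A B F H K' X).PosSemidef) : (X - X').PosSemidef := by
  refine hK'.posSemidef_of_lyapunov (by rw [Matrix.transpose_sub, hX, hX']) h ?_
  rw [← closedLoopLyap_sub (F := F) (H := H), h', sub_zero, add_neg_cancel]

variable [DecidableEq m]

/-- The Riccati operator: the left-hand side of the control Riccati equation. -/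
noncomputable def ricc (A : Matrix n n ℝ) (B : Matrix n m ℝ) (F : Matrix q n ℝ) (H : Matrix q m ℝ)
    (X : Matrix n n ℝ) : Matrix n n ℝ :=
  Aᵀ * X + X * A - (X * B + Fᵀ * H) * (Hᵀ * H)⁻¹ * (X * B + Fᵀ * H)ᵀ + Fᵀ * F

/-- The feedback gain `-Ψ⁻¹(XB + FᵀH)ᵀ` associated with `X`. -/
noncomputable def gain (B : Matrix n m ℝ) (F : Matrix q n ℝ) (H : Matrix q m ℝ)
    (X : Matrix n n ℝ) : Matrix m n ℝ :=
  -((Hᵀ * H)⁻¹ * (X * B + Fᵀ * H)ᵀ)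

theorem areP_iff {X : Matrix n n ℝ} {K : Matrix m n ℝ} :
    AREp A B F H X K ↔ ricc A B F H X = 0 ∧ K = gain B F H X := Iff.rfl

/-- Completion of squares: replacing the optimal gain by an arbitrary `K` costs
`(K - gain X)ᵀ Ψ (K - gain X)`. -/
theorem closedLoopLyap_eq (hH : IsUnit (Hᵀ * H).det) {X : Matrix n n ℝ} (hX : Xᵀ = X)
    (K : Matrix m n ℝ) :
    closedLoopLyap A B F H K X = ricc A B F H X
      + (H * (K - gain B F H X))ᵀ * (H * (K - gain B F H X)) := by
  set S := X * B + Fᵀ * H with hS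
  have hSt : Sᵀ = Bᵀ * X + Hᵀ * F := by
    rw [hS]
    simp only [Matrix.transpose_add, Matrix.transpose_mul, Matrix.transpose_transpose, hX]
  have hΨ : Hᵀ * H * gain B F H X = -Sᵀ := by
    rw [gain, Matrix.mul_neg, ← Matrix.mul_assoc, Matrix.mul_nonsing_inv _ hH, Matrix.one_mul]
  have hΨ' : (gain B F H X)ᵀ * (Hᵀ * H) = -S := by
    have := congrArg Matrix.transpose hΨ
    simpa [Matrix.transpose_mul, Matrix.mul_assoc] using this
  have hr : ricc A B F H X = Aᵀ * X + X * A + S * gain B F H X + Fᵀ * F := by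
    rw [ricc, gain, Matrix.mul_neg, ← hS, Matrix.mul_assoc, sub_eq_add_neg]
  have e : (H * (K - gain B F H X))ᵀ * (H * (K - gain B F H X))
      = Kᵀ * (Hᵀ * H) * K - Kᵀ * (Hᵀ * H * gain B F H X)
        - (gain B F H X)ᵀ * (Hᵀ * H) * K + (gain B F H X)ᵀ * (Hᵀ * H) * gain B F H X := by
    simp only [Matrix.transpose_mul, Matrix.transpose_sub, Matrix.mul_sub, Matrix.sub_mul,
      Matrix.mul_assoc]
    abel
  rw [e, hΨ, hΨ', hr, hSt, hS, closedLoopLyap]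
  simp only [Matrix.transpose_mul, Matrix.transpose_add, Matrix.mul_add, Matrix.add_mul,
    Matrix.mul_neg, Matrix.neg_mul, Matrix.mul_assoc]
  abel

theorem closedLoopLyap_gain (hH : IsUnit (Hᵀ * H).det) {X : Matrix n n ℝ} (hX : Xᵀ = X) :
    closedLoopLyap A B F H (gain B F H X) X = ricc A B F H X := by
  simp [closedLoopLyap_eq hH hX]

theorem gain_continuous : Continuous (gain B F H) := by
  unfold gain
  fun_prop

variable [DecidableEq n]

/-- Policy evaluation and improvement: the cost of a stabilizing gain is positive semidefinite, and
the gain derived from that cost is again stabilizing. -/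
theorem exists_cost_of_hurwitz (hH : IsUnit (Hᵀ * H).det) {K : Matrix m n ℝ}
    (hK : IsHurwitz (A + B * K)) :
    ∃ X : Matrix n n ℝ, X.PosSemidef ∧ closedLoopLyap A B F H K X = 0 ∧
      IsHurwitz (A + B * gain B F H X) := by
  obtain ⟨X, hX, hlyap⟩ := hK.exists_lyapunov (posSemidef_gram (F + H * K))
  refine ⟨X, hX, hlyap, isHurwitz_iff.2 fun z v hz hv => ?_⟩
  have hs := isSymm_of_posSemidef hX
  have h1 : closedLoopLyap A B F H (gain B F H X) X
      + (H * (K - gain B F H X))ᵀ * (H * (K - gain B F H X)) = 0 := by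
    rw [closedLoopLyap_gain hH hs, ← closedLoopLyap_eq hH hs]
    exact hlyap
  have h2 := (mulVec_eq_zero_of_lyapunov hX h1 hz hv).2
  -- The two gains agree on `v`, so `v` is an eigenvector of the old closed loop as well.
  have h3 : cplx (K - gain B F H X) *ᵥ v = 0 := by
    rw [cplx_mul, ← Matrix.mulVec_mulVec] at h2
    refine cplx_mulVec_eq_zero_of_leftInverse (N := (Hᵀ * H)⁻¹ * Hᵀ) ?_ h2
    rw [Matrix.mul_assoc, Matrix.nonsing_inv_mul _ hH]
  refine isHurwitz_iff.1 hK z v hz ?_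
  have h4 : A + B * K = (A + B * gain B F H X) + B * (K - gain B F H X) := by
    rw [Matrix.mul_sub]; abel
  rw [h4, cplx_add, Matrix.add_mulVec, hv, cplx_mul, ← Matrix.mulVec_mulVec, h3,
    Matrix.mulVec_zero, add_zero]

/-- A stabilizing symmetric solution dominates every symmetric solution of the Riccati
equation. -/
theorem posSemidef_sub_of_ricc (hH : IsUnit (Hᵀ * H).det) {X X' : Matrix n n ℝ} (hX : Xᵀ = X)
    (hX' : X'ᵀ = X') (h : ricc A B F H X = 0) (h' : ricc A B F H X' = 0)
    (hs : IsHurwitz (A + B * gain B F H X)) : (X - X').PosSemidef := by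
  refine hs.posSemidef_of_lyapunov (by rw [Matrix.transpose_sub, hX, hX'])
    (posSemidef_gram (H * (gain B F H X - gain B F H X'))) ?_
  have e1 := closedLoopLyap_gain (A := A) (B := B) (F := F) hH hX
  have e2 := closedLoopLyap_eq (A := A) (B := B) (F := F) hH hX' (gain B F H X)
  rw [h] at e1
  rw [h', zero_add] at e2
  rw [← closedLoopLyap_sub (F := F) (H := H), ← e2, e1, zero_sub, neg_add_cancel]

theorem eq_of_stabilizing (hH : IsUnit (Hᵀ * H).det) {X X' : Matrix n n ℝ} (hX : Xᵀ = X)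
    (hX' : X'ᵀ = X') (h : ricc A B F H X = 0) (h' : ricc A B F H X' = 0)
    (hs : IsHurwitz (A + B * gain B F H X)) (hs' : IsHurwitz (A + B * gain B F H X')) :
    X' = X :=
  eq_of_posSemidef_sub (posSemidef_sub_of_ricc hH hX' hX h' h hs')
    (posSemidef_sub_of_ricc hH hX hX' h h' hs)

/-- Kleinman's policy iteration converges to a positive semidefinite solution of the Riccati
equation whose closed loop has no eigenvalue in the open right half plane. -/
theorem exists_ricc_eq_zero (hH : IsUnit (Hᵀ * H).det) (hAB : Stabilizable A B) :
    ∃ X : Matrix n n ℝ, X.PosSemidef ∧ ricc A B F H X = 0 ∧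
      ∀ (z : ℂ) (v : n → ℂ), 0 < z.re → cplx (A + B * gain B F H X) *ᵥ v = z • v → v = 0 := by
  obtain ⟨K₀, hK₀⟩ := hAB
  choose Φ hΦ hlyap hgain using fun K : {K : Matrix m n ℝ // IsHurwitz (A + B * K)} =>
    exists_cost_of_hurwitz (F := F) hH K.2
  let κ : ℕ → {K : Matrix m n ℝ // IsHurwitz (A + B * K)} :=
    fun k => (fun K => ⟨gain B F H (Φ K), hgain K⟩)^[k] ⟨K₀, hK₀⟩
  have hκ : ∀ k, (κ (k + 1)).1 = gain B F H (Φ (κ k)) := fun k => by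
    simp only [κ, Function.iterate_succ_apply']
  have hmono : ∀ k, (Φ (κ k) - Φ (κ (k + 1))).PosSemidef := by
    intro k
    have hs := isSymm_of_posSemidef (hΦ (κ k))
    refine posSemidef_sub_of_closedLoopLyap (κ (k + 1)).2 hs
      (isSymm_of_posSemidef (hΦ _)) (hlyap (κ (k + 1))) ?_
    have e := closedLoopLyap_eq (A := A) (B := B) (F := F) hH hs (κ k).1
    rw [hlyap (κ k)] at e
    rw [hκ, closedLoopLyap_gain hH hs, neg_eq_of_add_eq_zero_right e.symm]
    exact posSemidef_gram _
  obtain ⟨X, hX, hlim⟩ := exists_tendsto_of_posSemidef_sub (fun k => hΦ (κ k)) hmono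
  have hs := isSymm_of_posSemidef hX
  have hlim' : Tendsto (fun k => Φ (κ (k + 1))) atTop (𝓝 X) :=
    hlim.comp (tendsto_add_atTop_nat 1)
  have hK : Tendsto (fun k => gain B F H (Φ (κ k))) atTop (𝓝 (gain B F H X)) :=
    (gain_continuous.tendsto X).comp hlim
  refine ⟨X, hX, ?_, fun z v hz hv => ?_⟩
  · have hc : Continuous fun P : Matrix m n ℝ × Matrix n n ℝ =>
        closedLoopLyap A B F H P.1 P.2 := by
      unfold closedLoopLyap
      fun_prop
    have h1 := (hc.tendsto (gain B F H X, X)).comp (hK.prodMk_nhds hlim')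
    have h2 : ∀ k, closedLoopLyap A B F H (gain B F H (Φ (κ k))) (Φ (κ (k + 1))) = 0 := by
      intro k
      rw [← hκ]
      exact hlyap _
    simp only [Function.comp_def, h2] at h1
    rw [← closedLoopLyap_gain hH hs]
    exact (tendsto_nhds_unique tendsto_const_nhds h1).symm
  · have hc : Continuous fun K : Matrix m n ℝ => A + B * K := by fun_prop
    exact eq_zero_of_tendsto_hurwitz (fun k => hgain (κ k)) ((hc.tendsto _).comp hK) hz hv

/-- An eigenvector of the closed loop of a positive semidefinite solution in the closed right half
plane has zero output, so it yields a kernel vector `(v, Kv)` of the pencil. -/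
theorem eq_zero_of_pencil (hH : IsUnit (Hᵀ * H).det) {X : Matrix n n ℝ} (hX : X.PosSemidef)
    (h : ricc A B F H X = 0) {z : ℂ} (hz : 0 ≤ z.re)
    (hpen : ∀ (x : n → ℂ) (u : m → ℂ), cplx A *ᵥ x + cplx B *ᵥ u = z • x →
      cplx F *ᵥ x + cplx H *ᵥ u = 0 → x = 0)
    {v : n → ℂ} (hv : cplx (A + B * gain B F H X) *ᵥ v = z • v) : v = 0 := by
  have h1 : closedLoopLyap A B F H (gain B F H X) X
      + (0 : Matrix q n ℝ)ᵀ * (0 : Matrix q n ℝ) = 0 := by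
    rw [closedLoopLyap_gain hH (isSymm_of_posSemidef hX), h, Matrix.mul_zero, add_zero]
  have h2 := (mulVec_eq_zero_of_lyapunov hX h1 hz hv).1
  refine hpen v (cplx (gain B F H X) *ᵥ v) ?_ ?_
  · rw [← hv, cplx_add, cplx_mul, Matrix.add_mulVec, Matrix.mulVec_mulVec]
  · rw [← h2, cplx_add, cplx_mul, Matrix.add_mulVec, Matrix.mulVec_mulVec]

/-- Existence and uniqueness of the stabilizing solution, when `(A, B)` is stabilizable and the
pencil has no kernel on the imaginary axis. -/
theorem exists_isTheStabilizingAREp (hH : IsUnit (Hᵀ * H).det) (hAB : Stabilizable A B)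
    (hpen : ∀ (z : ℂ) (x : n → ℂ) (u : m → ℂ), z.re = 0 →
      cplx A *ᵥ x + cplx B *ᵥ u = z • x → cplx F *ᵥ x + cplx H *ᵥ u = 0 → x = 0) :
    ∃ (X : Matrix n n ℝ) (K : Matrix m n ℝ), IsTheStabilizingAREp A B F H X K := by
  obtain ⟨X, hX, hr, hopen⟩ := exists_ricc_eq_zero (F := F) hH hAB
  have hhur : IsHurwitz (A + B * gain B F H X) := isHurwitz_iff.2 fun z v hz hv => by
    rcases hz.eq_or_lt with h0 | h0
    · exact eq_zero_of_pencil hH hX hr hz (fun x u => hpen z x u h0.symm) hv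
    · exact hopen z v h0 hv
  refine ⟨X, gain B F H X, ⟨hr, rfl⟩, hX, hhur, fun X' K' h' hs' hh' => ?_⟩
  obtain ⟨hr', rfl⟩ := areP_iff.1 h'
  obtain rfl : X' = X := eq_of_stabilizing hH (isSymm_of_posSemidef hX) hs' hr hr' hhur hh'
  exact ⟨rfl, rfl⟩

/-- When the pencil has no kernel on the whole closed right half plane, every positive semidefinite
solution is stabilizing, so there is only one. -/
theorem exists_isUniquePSDAREp (hH : IsUnit (Hᵀ * H).det) (hAB : Stabilizable A B)
    (hpen : ∀ (z : ℂ) (x : n → ℂ) (u : m → ℂ), 0 ≤ z.re →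
      cplx A *ᵥ x + cplx B *ᵥ u = z • x → cplx F *ᵥ x + cplx H *ᵥ u = 0 → x = 0) :
    ∃ (X : Matrix n n ℝ) (K : Matrix m n ℝ), IsUniquePSDAREp A B F H X K := by
  obtain ⟨X, K, h, hX, hhur, huniq⟩ :=
    exists_isTheStabilizingAREp (F := F) hH hAB fun z x u hz => hpen z x u hz.ge
  refine ⟨X, K, h, hX, hhur, fun X' K' h' hX' => huniq X' K' h' (isSymm_of_posSemidef hX') ?_⟩
  obtain ⟨hr', rfl⟩ := areP_iff.1 h'
  exact isHurwitz_iff.2 fun z v hz hv =>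
    eq_zero_of_pencil hH hX' hr' hz (fun x u => hpen z x u hz) hv

end Riccati

/-! ### The pencil condition -/

section Pencil

variable {n m q : Type*} [Fintype n] [DecidableEq n] [Fintype m]

theorem FullColRank.isUnit_det_gram [DecidableEq m] [Fintype q] {H : Matrix q m ℝ}
    (hH : FullColRank H) : IsUnit (Hᵀ * H).det := by
  have := (Matrix.PosDef.conjTranspose_mul_self H (Matrix.mulVec_injective_iff.2 hH)).isUnit
  rwa [Matrix.conjTranspose_eq_transpose_of_trivial, Matrix.isUnit_iff_isUnit_det] at this

theorem eq_zero_of_fullColRank_pencil {A : Matrix n n ℝ} {B : Matrix n m ℝ} {F : Matrix q n ℝ}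
    {H : Matrix q m ℝ} (h : ∀ ω : ℝ, FullColRank (pencil A B F H ω)) {z : ℂ} {x : n → ℂ}
    {u : m → ℂ} (hz : z.re = 0) (h1 : cplx A *ᵥ x + cplx B *ᵥ u = z • x)
    (h2 : cplx F *ᵥ x + cplx H *ᵥ u = 0) : x = 0 := by
  have hz' : z = Complex.I * (z.im : ℂ) := by
    apply Complex.ext <;> simp [hz]
  have hinj := Matrix.mulVec_injective_iff.2 (h z.im)
  have h0 : pencil A B F H z.im *ᵥ Sum.elim x u = pencil A B F H z.im *ᵥ 0 := by
    rw [pencil, Matrix.fromBlocks_mulVec, ← hz', Matrix.mulVec_zero]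
    ext (i | i)
    · have := congrFun h1 i
      simp [Matrix.sub_mulVec, Matrix.smul_mulVec] at this ⊢
      linear_combination this
    · simpa using congrFun h2 i
  ext i
  simpa using congrFun (hinj h0) (Sum.inl i)

/-- The recursion step. If the gain `K` stabilizes `(A, B)` and `(A', B')` is the restriction of
`(A, B)` to invariant subspaces, embedded by `E` and `G`, then the Riccati equation of
`(A', B')` with output `HGu - HKEx` has a unique positive semidefinite solution: vanishing output
means that the input `Gu` equals the feedback `KEx`, and hence that `Ex` is an eigenvector of
`A + BK`. -/
theorem exists_isUniquePSDAREp_restrict [DecidableEq m] [Fintype q] {n' m' : Type*}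
    [Fintype n'] [DecidableEq n'] [Fintype m'] [DecidableEq m']
    {A : Matrix n n ℝ} {B : Matrix n m ℝ} {H : Matrix q m ℝ} {K : Matrix m n ℝ}
    {A' : Matrix n' n' ℝ} {B' : Matrix n' m' ℝ} {E : Matrix n n' ℝ}
    {E' : Matrix n' n ℝ} {G : Matrix m m' ℝ} (hE : E' * E = 1) (hA : A * E = E * A')
    (hB : B * G = E * B') (hH : IsUnit (Hᵀ * H).det) (hHG : IsUnit ((H * G)ᵀ * (H * G)).det)
    (hK : IsHurwitz (A + B * K)) (hAB : Stabilizable A' B') :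
    ∃ (X : Matrix n' n' ℝ) (K' : Matrix m' n' ℝ),
      IsUniquePSDAREp A' B' (-(H * (K * E))) (H * G) X K' := by
  refine exists_isUniquePSDAREp hHG hAB fun z x u hz h1 h2 => ?_
  have h3 : cplx (K * E) *ᵥ x = cplx G *ᵥ u := by
    rw [← sub_eq_zero, ← neg_eq_zero]
    refine cplx_mulVec_eq_zero_of_leftInverse (M := H) (N := (Hᵀ * H)⁻¹ * Hᵀ) ?_ ?_
    · rw [Matrix.mul_assoc, Matrix.nonsing_inv_mul _ hH]
    · rw [← h2, neg_sub, Matrix.mulVec_sub, cplx_neg, cplx_mul H (K * E), cplx_mul H G,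
        Matrix.neg_mulVec, Matrix.mulVec_mulVec, Matrix.mulVec_mulVec, sub_eq_neg_add]
  refine cplx_mulVec_eq_zero_of_leftInverse hE (isHurwitz_iff.1 hK z _ hz ?_)
  calc cplx (A + B * K) *ᵥ (cplx E *ᵥ x)
      = cplx (A * E) *ᵥ x + cplx B *ᵥ (cplx (K * E) *ᵥ x) := by
        simp only [Matrix.mulVec_mulVec, ← cplx_mul, ← Matrix.add_mulVec, ← cplx_add,
          Matrix.add_mul, Matrix.mul_assoc]
    _ = cplx E *ᵥ (cplx A' *ᵥ x + cplx B' *ᵥ u) := by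
        rw [h3, hA, Matrix.mulVec_mulVec, ← cplx_mul, hB, Matrix.mulVec_add]
        simp only [cplx_mul, Matrix.mulVec_mulVec]
    _ = z • (cplx E *ᵥ x) := by rw [h1, Matrix.mulVec_smul]

end Pencil

/-! ### Restriction to invariant coordinate subspaces -/

section Submatrix

variable {a b c : Type*} [DecidableEq a]

/-- The matrix of extension by zero along `f`. -/
def emb (f : b → a) : Matrix a b ℝ := (1 : Matrix a a ℝ).submatrix id f

theorem mul_emb [Fintype a] (M : Matrix c a ℝ) (f : b → a) : M * emb f = M.submatrix id f := by
  ext x y; simp [emb, Matrix.mul_apply, Matrix.one_apply]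

theorem transpose_emb_mul_emb [Fintype a] [DecidableEq b] {f : b → a}
    (hf : Function.Injective f) : (emb f)ᵀ * emb f = 1 := by
  rw [mul_emb]
  ext x y
  simp [emb, Matrix.one_apply, hf.eq_iff]

/-- If the coordinate subspace along `g` is mapped by `M` into the one along `f`, extension by zero
intertwines `M` with its submatrix. -/
theorem mul_emb_eq_emb_mul {a' b' : Type*} [Fintype a'] [DecidableEq a'] [Fintype b]
    {M : Matrix a a' ℝ} {f : b → a} {g : b' → a'} (hf : Function.Injective f)
    (h : ∀ x ∉ Set.range f, ∀ y, M x (g y) = 0) : M * emb g = emb f * M.submatrix f g := by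
  classical
  rw [mul_emb]
  ext x y
  by_cases hx : x ∈ Set.range f
  · obtain ⟨w, rfl⟩ := hx
    simp [emb, Matrix.mul_apply, Matrix.one_apply, hf.eq_iff]
  · rw [Matrix.mul_apply, Finset.sum_eq_zero]
    · exact h x hx y
    · intro w _
      have : x ≠ f w := fun e => hx ⟨w, e.symm⟩
      simp [emb, this]

theorem FullColRank.submatrix {m q m' : Type*} {H : Matrix q m ℝ} {g : m' → m}
    (hH : FullColRank H) (hg : Function.Injective g) : FullColRank (H.submatrix id g) :=
  LinearIndependent.comp hH g hg

variable {n m q n' m' : Type*} [Fintype n] [DecidableEq n] [Fintype m] [DecidableEq m]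
  [Fintype n'] [DecidableEq n'] [Fintype m']
  {A : Matrix n n ℝ} {B : Matrix n m ℝ} {H : Matrix q m ℝ} {K : Matrix m n ℝ}
  {f : n' → n} {g : m' → m}

/-- Stability of a closed loop passes to a coordinate subspace invariant under all the data. -/
theorem IsHurwitz.submatrix (hf : Function.Injective f) (hg : Function.Injective g)
    (hA : ∀ x ∉ Set.range f, ∀ y, A x (f y) = 0) (hB : ∀ x ∉ Set.range f, ∀ y, B x (g y) = 0)
    (hKfg : ∀ x ∉ Set.range g, ∀ y, K x (f y) = 0) (hK : IsHurwitz (A + B * K)) :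
    IsHurwitz (A.submatrix f f + B.submatrix f g * K.submatrix g f) := by
  refine hK.of_intertwine (transpose_emb_mul_emb hf) ?_
  rw [Matrix.add_mul, Matrix.mul_add, mul_emb_eq_emb_mul hf hA, Matrix.mul_assoc,
    mul_emb_eq_emb_mul hg hKfg, ← Matrix.mul_assoc, mul_emb_eq_emb_mul hf hB, Matrix.mul_assoc]

/-- `exists_isUniquePSDAREp_restrict` for coordinate subspaces. -/
theorem exists_isUniquePSDAREp_submatrix [Fintype q] [DecidableEq m']
    (hf : Function.Injective f) (hg : Function.Injective g)
    (hA : ∀ x ∉ Set.range f, ∀ y, A x (f y) = 0) (hB : ∀ x ∉ Set.range f, ∀ y, B x (g y) = 0)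
    (hH : FullColRank H) (hK : IsHurwitz (A + B * K))
    (hAB : Stabilizable (A.submatrix f f) (B.submatrix f g)) :
    ∃ (X : Matrix n' n' ℝ) (K' : Matrix m' n' ℝ), IsUniquePSDAREp (A.submatrix f f)
      (B.submatrix f g) (-(H * K.submatrix id f)) (H.submatrix id g) X K' := by
  have := exists_isUniquePSDAREp_restrict (transpose_emb_mul_emb hf) (mul_emb_eq_emb_mul hf hA)
    (mul_emb_eq_emb_mul hf hB) hH.isUnit_det_gram
    (by rw [mul_emb]; exact (hH.submatrix hg).isUnit_det_gram) hK hAB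
  rwa [mul_emb, mul_emb] at this

end Submatrix

/-! ### Duality of control and filtering -/

section Duality

theorem isHurwitz_observer_iff {n p : Type*} [Fintype n] [DecidableEq n] [Fintype p]
    {A : Matrix n n ℝ} {C : Matrix p n ℝ} {L : Matrix n p ℝ} :
    IsHurwitz (A + L * C) ↔ IsHurwitz (Aᵀ + Cᵀ * Lᵀ) := by
  rw [← isHurwitz_transpose_iff, Matrix.transpose_add, Matrix.transpose_mul]

theorem detectable_iff {n p : Type*} [Fintype n] [DecidableEq n] [Fintype p] {A : Matrix n n ℝ}
    {C : Matrix p n ℝ} : Detectable C A ↔ Stabilizable Aᵀ Cᵀ := by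
  constructor
  · rintro ⟨L, hL⟩
    exact ⟨Lᵀ, isHurwitz_observer_iff.1 hL⟩
  · rintro ⟨K, hK⟩
    exact ⟨Kᵀ, isHurwitz_observer_iff.2 (by simpa using hK)⟩

theorem FullRowRank.transpose {𝕜 a b : Type*} [Field 𝕜] {M : Matrix a b 𝕜} (h : FullRowRank M) :
    FullColRank Mᵀ := h

theorem pencil_transpose {n p r : Type*} [DecidableEq n] {A : Matrix n n ℝ}
    {C : Matrix p n ℝ} {W : Matrix n r ℝ} {V : Matrix p r ℝ} (ω : ℝ) :
    (pencil A W C V ω)ᵀ = pencil Aᵀ Cᵀ Wᵀ Vᵀ ω := by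
  rw [pencil, Matrix.fromBlocks_transpose, pencil, Matrix.transpose_sub, Matrix.transpose_smul,
    Matrix.transpose_one]
  rfl

variable {n p r : Type*} [Fintype n] [Fintype p] [DecidableEq p] [Fintype r]
  {A : Matrix n n ℝ} {C : Matrix p n ℝ} {W : Matrix n r ℝ} {V : Matrix p r ℝ}
  {Y : Matrix n n ℝ} {L : Matrix n p ℝ}

/-- Symmetry of `Y` is needed: the first equation of `AREd` contains `(CY)ᵀ = YᵀCᵀ`, that of the
transposed `AREp` contains `YCᵀ`. -/
theorem areD_iff (hY : Yᵀ = Y) : AREd A C W V Y L ↔ AREp Aᵀ Cᵀ Wᵀ Vᵀ Y Lᵀ := by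
  have h1 : (C * Y + V * Wᵀ)ᵀ = Y * Cᵀ + W * Vᵀ := by
    simp [Matrix.transpose_mul, hY]
  have h2 : C * Y + V * Wᵀ = (Y * Cᵀ + W * Vᵀ)ᵀ := by rw [← h1, Matrix.transpose_transpose]
  have h3 : ((V * Vᵀ)⁻¹)ᵀ = (V * Vᵀ)⁻¹ := by
    rw [Matrix.transpose_nonsing_inv, Matrix.transpose_mul, Matrix.transpose_transpose]
  unfold AREd AREp
  rw [h1, h2]
  simp only [Matrix.transpose_transpose]
  refine and_congr Iff.rfl ?_
  rw [← Matrix.transpose_inj (A := L), Matrix.transpose_neg, Matrix.transpose_mul, h3]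

variable [DecidableEq n]

theorem IsTheStabilizingAREp.dual {K : Matrix p n ℝ}
    (h : IsTheStabilizingAREp Aᵀ Cᵀ Wᵀ Vᵀ Y K) : IsTheStabilizingAREd A C W V Y Kᵀ := by
  obtain ⟨h1, h2, h3, h4⟩ := h
  refine ⟨(areD_iff (isSymm_of_posSemidef h2)).2 (by simpa using h1), h2,
    isHurwitz_observer_iff.2 (by simpa using h3), fun Y' L' hd hs hh => ?_⟩
  obtain ⟨e1, e2⟩ := h4 Y' L'ᵀ ((areD_iff hs).1 hd) hs (isHurwitz_observer_iff.1 hh)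
  exact ⟨e1, by rw [← e2, Matrix.transpose_transpose]⟩

theorem IsUniquePSDAREp.dual {K : Matrix p n ℝ}
    (h : IsUniquePSDAREp Aᵀ Cᵀ Wᵀ Vᵀ Y K) : IsUniquePSDAREd A C W V Y Kᵀ := by
  obtain ⟨h1, h2, h3, h4⟩ := h
  refine ⟨(areD_iff (isSymm_of_posSemidef h2)).2 (by simpa using h1), h2,
    isHurwitz_observer_iff.2 (by simpa using h3), fun Y' L' hd hs => ?_⟩
  obtain ⟨e1, e2⟩ := h4 Y' L'ᵀ ((areD_iff (isSymm_of_posSemidef hs)).1 hd) hs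
  exact ⟨e1, by rw [← e2, Matrix.transpose_transpose]⟩

end Duality

/-! ### Block triangular matrices -/

section Triangular

variable {N : ℕ} {a b c : Fin N → ℕ}

theorem IsLBT.add {M M' : Matrix (Idx a) (Idx b) ℝ} (h : IsLBT M) (h' : IsLBT M') :
    IsLBT (M + M') := fun x y hxy => by
  rw [Matrix.add_apply, h x y hxy, h' x y hxy, add_zero]

theorem IsLBT.mul {M : Matrix (Idx a) (Idx b) ℝ} {M' : Matrix (Idx b) (Idx c) ℝ} (h : IsLBT M)
    (h' : IsLBT M') : IsLBT (M * M') := fun x y hxy => by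
  rw [Matrix.mul_apply]
  refine Finset.sum_eq_zero fun w _ => ?_
  rcases lt_or_ge x.1 w.1 with hw | hw
  · rw [h x w hw, zero_mul]
  · rw [h' w y (hw.trans_lt hxy), mul_zero]

theorem IsLBT.diagBlock_mul {M : Matrix (Idx a) (Idx b) ℝ} {M' : Matrix (Idx b) (Idx c) ℝ}
    (h : IsLBT M) (h' : IsLBT M') (i : Fin N) :
    diagBlock (M * M') i = diagBlock M i * diagBlock M' i := by
  ext k l
  simp only [diagBlock, Matrix.submatrix_apply, Matrix.mul_apply]
  rw [Fintype.sum_sigma, Finset.sum_eq_single i]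
  · intro j _ hj
    refine Finset.sum_eq_zero fun t _ => ?_
    rcases lt_or_gt_of_ne hj with hlt | hlt
    · rw [h' ⟨j, t⟩ ⟨i, l⟩ hlt, mul_zero]
    · rw [h ⟨i, k⟩ ⟨j, t⟩ hlt, zero_mul]
  · simp

theorem isLBT_blockDiagonal' (K : ∀ i, Matrix (Fin (a i)) (Fin (b i)) ℝ) :
    IsLBT (Matrix.blockDiagonal' K) := fun x y hxy =>
  Matrix.blockDiagonal'_apply_ne K x.2 y.2 hxy.ne

theorem diagBlock_blockDiagonal' (K : ∀ i, Matrix (Fin (a i)) (Fin (b i)) ℝ) (i : Fin N) :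
    diagBlock (Matrix.blockDiagonal' K) i = K i := by
  ext k l
  exact Matrix.blockDiagonal'_apply_eq K i k l

/-- A block triangular matrix with Hurwitz diagonal blocks is Hurwitz: the first nonzero block of an
eigenvector would be an eigenvector of a diagonal block. -/
theorem IsLBT.isHurwitz {M : Matrix (Idx a) (Idx a) ℝ} (h : IsLBT M)
    (hd : ∀ i, IsHurwitz (diagBlock M i)) : IsHurwitz M := by
  refine isHurwitz_iff.2 fun z v hz hv => ?_
  have key : ∀ i : Fin N, (fun k => v ⟨i, k⟩) = 0 := by
    intro i
    induction i using WellFoundedLT.induction with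
    | ind i ih =>
      refine isHurwitz_iff.1 (hd i) z _ hz ?_
      ext k
      have h1 := congrFun hv ⟨i, k⟩
      rw [Matrix.mulVec, dotProduct, Fintype.sum_sigma, Finset.sum_eq_single i] at h1
      · exact h1
      · intro j _ hj
        refine Finset.sum_eq_zero fun t _ => ?_
        rcases lt_or_gt_of_ne hj with hlt | hlt
        · rw [show v ⟨j, t⟩ = 0 from congrFun (ih j hlt) t, mul_zero]
        · rw [cplx, Matrix.map_apply, h ⟨i, k⟩ ⟨j, t⟩ hlt, Complex.ofReal_zero, zero_mul]
      · simp
  ext ⟨i, k⟩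
  exact congrFun (key i) k

theorem IsLBT.exists_stabilizing {A : Matrix (Idx a) (Idx a) ℝ} {B : Matrix (Idx a) (Idx b) ℝ}
    (hA : IsLBT A) (hB : IsLBT B) (h : ∀ i, Stabilizable (diagBlock A i) (diagBlock B i)) :
    ∃ K, IsLBT K ∧ IsHurwitz (A + B * K) := by
  choose K hK using h
  have hlbt := isLBT_blockDiagonal' K
  refine ⟨_, hlbt, (hA.add (hB.mul hlbt)).isHurwitz fun i => ?_⟩
  have : diagBlock (A + B * Matrix.blockDiagonal' K) i
      = diagBlock A i + diagBlock (B * Matrix.blockDiagonal' K) i := rfl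
  rw [this, hB.diagBlock_mul hlbt, diagBlock_blockDiagonal']
  exact hK i

theorem IsLBT.exists_detecting {A : Matrix (Idx a) (Idx a) ℝ} {C : Matrix (Idx b) (Idx a) ℝ}
    (hA : IsLBT A) (hC : IsLBT C) (h : ∀ i, Detectable (diagBlock C i) (diagBlock A i)) :
    ∃ L, IsLBT L ∧ IsHurwitz (A + L * C) := by
  choose L hL using h
  have hlbt := isLBT_blockDiagonal' L
  refine ⟨_, hlbt, (hA.add (hlbt.mul hC)).isHurwitz fun i => ?_⟩
  have : diagBlock (A + Matrix.blockDiagonal' L * C) i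
      = diagBlock A i + diagBlock (Matrix.blockDiagonal' L * C) i := rfl
  rw [this, hlbt.diagBlock_mul hC, diagBlock_blockDiagonal']
  exact hL i

theorem notMem_range_val_down {i : Fin N} {x : Idx a}
    (h : x ∉ Set.range (Subtype.val : Down a i → Idx a)) : x.1 < i := by
  simpa using h

theorem notMem_range_val_up {i : Fin N} {x : Idx a}
    (h : x ∉ Set.range (Subtype.val : Up a i → Idx a)) : i < x.1 := by
  simpa using h

theorem notMem_range_incl_down {i j : Fin N} (hij : i ≤ j) {x : Down a i}
    (h : x ∉ Set.range (Down.incl hij : Down a j → Down a i)) : x.1.1 < j := by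
  by_contra hx
  exact h ⟨⟨x.1, not_lt.1 hx⟩, rfl⟩

theorem notMem_range_incl_up {i j : Fin N} (hij : i ≤ j) {x : Up a j}
    (h : x ∉ Set.range (Up.incl hij : Up a i → Up a j)) : i < x.1.1 := by
  by_contra hx
  exact h ⟨⟨x.1, not_lt.1 hx⟩, rfl⟩

theorem Down.incl_injective {i j : Fin N} (hij : i ≤ j) :
    Function.Injective (Down.incl hij : Down a j → Down a i) := fun _ _ h =>
  Subtype.ext (congrArg (fun w : Down a i => w.1) h)

theorem Up.incl_injective {i j : Fin N} (hij : i ≤ j) :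
    Function.Injective (Up.incl hij : Up a i → Up a j) := fun _ _ h =>
  Subtype.ext (congrArg (fun w : Up a j => w.1) h)

/-- Dependent recursion along `Fin N`, for relations that can be solved step by step as long as an
invariant `P` is maintained. -/
theorem exists_seq_fin {T : Fin N → Type*} {P : ∀ i, T i → Prop} {Q : ∀ i, T i → Prop}
    {R : ∀ i j, T i → T j → Prop}
    (h0 : ∀ i : Fin N, (i : ℕ) = 0 → ∃ t, P i t ∧ Q i t)
    (hs : ∀ i j : Fin N, (i : ℕ) + 1 = (j : ℕ) → ∀ t, P i t → ∃ t', P j t' ∧ R i j t t') :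
    ∃ t : ∀ i, T i, (∀ i : Fin N, (i : ℕ) = 0 → Q i (t i)) ∧
      ∀ i j : Fin N, (i : ℕ) + 1 = (j : ℕ) → R i j (t i) (t j) := by
  choose t₀ hP₀ hQ₀ using h0
  choose s hP hR using hs
  let u : ∀ (k : ℕ) (hk : k < N), {t : T ⟨k, hk⟩ // P ⟨k, hk⟩ t} := fun k =>
    Nat.rec (fun hk => ⟨t₀ ⟨0, hk⟩ rfl, hP₀ _ _⟩)
      (fun k ih hk => ⟨s ⟨k, by omega⟩ ⟨k + 1, hk⟩ rfl (ih (by omega)).1 (ih (by omega)).2,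
        hP _ _ _ _ _⟩) k
  refine ⟨fun i => (u i i.2).1, ?_, ?_⟩
  · rintro ⟨_ | k, hk⟩ hi
    · exact hQ₀ _ _
    · simp at hi
  · rintro ⟨i, hi⟩ ⟨j, hj⟩ hij
    obtain rfl : i + 1 = j := hij
    exact hR ⟨i, hi⟩ ⟨i + 1, hj⟩ rfl (u i hi).1 (u i hi).2

/-- `exists_seq_fin` started at the last index and run downwards. -/
theorem exists_seq_fin_rev {T : Fin N → Type*} {P : ∀ i, T i → Prop} {Q : ∀ i, T i → Prop}
    {R : ∀ i j, T i → T j → Prop}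
    (h0 : ∀ i : Fin N, (i : ℕ) + 1 = N → ∃ t, P i t ∧ Q i t)
    (hs : ∀ i j : Fin N, (i : ℕ) + 1 = (j : ℕ) → ∀ t, P j t → ∃ t', P i t' ∧ R i j t' t) :
    ∃ t : ∀ i, T i, (∀ i : Fin N, (i : ℕ) + 1 = N → Q i (t i)) ∧
      ∀ i j : Fin N, (i : ℕ) + 1 = (j : ℕ) → R i j (t i) (t j) := by
  obtain ⟨t, h1, h2⟩ := exists_seq_fin (T := fun i => T i.rev) (P := fun i => P i.rev)
    (Q := fun i => Q i.rev) (R := fun i j x y => R j.rev i.rev y x)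
    (fun i hi => h0 _ (by rw [Fin.val_rev]; omega))
    (fun i j hij x hx => hs j.rev i.rev (by simp only [Fin.val_rev]; omega) x hx)
  have key : ∃ t' : ∀ i, T i, ∀ i, t' i.rev = t i :=
    ⟨fun i => i.rev_rev ▸ t i.rev, fun i => by
      have : ∀ (k : Fin N) (hk : k = i) (h : k.rev = i.rev), (h ▸ t k : T i.rev) = t i := by
        rintro k rfl _; rfl
      exact this _ i.rev_rev _⟩
  obtain ⟨t', ht'⟩ := key
  refine ⟨t', fun i hi => ?_, fun i j hij => ?_⟩
  · have := h1 i.rev (by rw [Fin.val_rev]; omega)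
    rwa [← ht', Fin.rev_rev] at this
  · have := h2 j.rev i.rev (by simp only [Fin.val_rev]; omega)
    rwa [← ht', ← ht', Fin.rev_rev, Fin.rev_rev] at this

end Triangular

/-! ### The two recursions -/

section Recursion

variable {N q r : ℕ} {n m p : Fin N → ℕ} {A : Matrix (Idx n) (Idx n) ℝ}

theorem exists_control_recursion {B : Matrix (Idx n) (Idx m) ℝ} {F : Matrix (Fin q) (Idx n) ℝ}
    {H : Matrix (Fin q) (Idx m) ℝ} (hA : IsLBT A) (hB : IsLBT B)
    (h_stab : ∀ i, Stabilizable (diagBlock A i) (diagBlock B i)) (hH : FullColRank H)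
    (h_col : ∀ ω : ℝ, FullColRank (pencil A B F H ω)) :
    ∃ (X₁ : Matrix (Idx n) (Idx n) ℝ) (K₁ : Matrix (Idx m) (Idx n) ℝ)
        (X : ∀ i : Fin N, Matrix (Down n i) (Down n i) ℝ)
        (K : ∀ i : Fin N, Matrix (Down m i) (Down n i) ℝ),
      IsTheStabilizingAREp A B F H X₁ K₁ ∧
      (∀ i : Fin N, (i : ℕ) = 0 → X i = dd X₁ i ∧ K i = dd K₁ i) ∧
      (∀ (i j : Fin N) (hij : (i : ℕ) + 1 = (j : ℕ)),
        IsUniquePSDAREp (dd A j) (dd B j)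
          (-(downCols H i * tailCols (le_of_succ hij) (K i))) (downCols H j)
          (X j) (K j)) := by
  obtain ⟨K₀, hK₀, hK₀'⟩ := hA.exists_stabilizing hB h_stab
  obtain ⟨X₁, K₁, h₁⟩ := exists_isTheStabilizingAREp (F := F) hH.isUnit_det_gram ⟨K₀, hK₀'⟩
    fun z x u hz => eq_zero_of_fullColRank_pencil h_col hz
  have hAv : ∀ j : Fin N, ∀ x ∉ Set.range (Subtype.val : Down n j → Idx n), ∀ y : Down n j,
      A x y = 0 := fun j x hx y => hA _ _ ((notMem_range_val_down hx).trans_le y.2)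
  have hBv : ∀ j : Fin N, ∀ x ∉ Set.range (Subtype.val : Down n j → Idx n), ∀ y : Down m j,
      B x y = 0 := fun j x hx y => hB _ _ ((notMem_range_val_down hx).trans_le y.2)
  have hsub : ∀ j, Stabilizable (dd A j) (dd B j) := fun j =>
    ⟨dd K₀ j, IsHurwitz.submatrix Subtype.val_injective Subtype.val_injective (hAv j) (hBv j)
      (fun x hx y => hK₀ _ _ ((notMem_range_val_down hx).trans_le y.2)) hK₀'⟩
  have hbase : ∀ i : Fin N, (i : ℕ) = 0 → IsHurwitz (dd A i + dd B i * dd K₁ i) := by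
    -- The range `↓i` is everything when `i` is the first block.
    intro i hi
    refine IsHurwitz.submatrix Subtype.val_injective Subtype.val_injective (hAv i) (hBv i)
      (fun x hx y => ?_) h₁.2.2.1
    have := Fin.lt_def.1 (notMem_range_val_down hx)
    omega
  have hstep : ∀ (i j : Fin N) (hij : (i : ℕ) + 1 = (j : ℕ)) (K : Matrix (Down m i) (Down n i) ℝ),
      IsHurwitz (dd A i + dd B i * K) → ∃ X K', IsUniquePSDAREp (dd A j) (dd B j)
        (-(downCols H i * tailCols (le_of_succ hij) K)) (downCols H j) X K' :=
    fun i j hij K hK => exists_isUniquePSDAREp_submatrix (A := dd A i) (B := dd B i)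
      (f := Down.incl (le_of_succ hij)) (g := Down.incl (le_of_succ hij))
      (Down.incl_injective _) (Down.incl_injective _)
      (fun x hx y => hA _ _ ((notMem_range_incl_down _ hx).trans_le y.2))
      (fun x hx y => hB _ _ ((notMem_range_incl_down _ hx).trans_le y.2))
      (hH.submatrix Subtype.val_injective : FullColRank (downCols H i)) hK (hsub j)
  obtain ⟨t, ht0, ht⟩ := exists_seq_fin
    (T := fun i => Matrix (Down n i) (Down n i) ℝ × Matrix (Down m i) (Down n i) ℝ)
    (P := fun i t => IsHurwitz (dd A i + dd B i * t.2))
    (Q := fun i t => t.1 = dd X₁ i ∧ t.2 = dd K₁ i)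
    (R := fun i j t t' => ∀ hij : (i : ℕ) + 1 = (j : ℕ), IsUniquePSDAREp (dd A j) (dd B j)
      (-(downCols H i * tailCols (le_of_succ hij) t.2)) (downCols H j) t'.1 t'.2)
    (fun i hi => ⟨(dd X₁ i, dd K₁ i), hbase i hi, rfl, rfl⟩)
    (fun i j hij t ht => by
      obtain ⟨X, K, h⟩ := hstep i j hij t.2 ht
      exact ⟨(X, K), h.2.2.1, fun _ => h⟩)
  exact ⟨X₁, K₁, fun i => (t i).1, fun i => (t i).2, h₁, ht0, fun i j hij => ht i j hij hij⟩

theorem exists_filter_recursion {C : Matrix (Idx p) (Idx n) ℝ} {W : Matrix (Idx n) (Fin r) ℝ}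
    {V : Matrix (Idx p) (Fin r) ℝ} (hA : IsLBT A) (hC : IsLBT C)
    (h_det : ∀ i, Detectable (diagBlock C i) (diagBlock A i)) (hV : FullRowRank V)
    (h_row : ∀ ω : ℝ, FullRowRank (pencil A W C V ω)) :
    ∃ (Y_N : Matrix (Idx n) (Idx n) ℝ) (L_N : Matrix (Idx n) (Idx p) ℝ)
        (Y : ∀ i : Fin N, Matrix (Up n i) (Up n i) ℝ)
        (L : ∀ i : Fin N, Matrix (Up n i) (Up p i) ℝ),
      IsTheStabilizingAREd A C W V Y_N L_N ∧
      (∀ i : Fin N, (i : ℕ) + 1 = N → Y i = uu Y_N i ∧ L i = uu L_N i) ∧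
      (∀ (i j : Fin N) (hij : (i : ℕ) + 1 = (j : ℕ)),
        IsUniquePSDAREd (uu A i) (uu C i)
          (-(headRows (le_of_succ hij) (L j) * upRows V j)) (upRows V i)
          (Y i) (L i)) := by
  obtain ⟨L₀, hL₀, hL₀'⟩ := hA.exists_detecting hC h_det
  have hV' : FullColRank Vᵀ := hV.transpose
  obtain ⟨Y₁, K₁, h₁⟩ := exists_isTheStabilizingAREp (A := Aᵀ) (B := Cᵀ) (F := Wᵀ)
    hV'.isUnit_det_gram (detectable_iff.1 ⟨L₀, hL₀'⟩)
    fun z x u hz => eq_zero_of_fullColRank_pencil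
      (fun ω => by rw [← pencil_transpose]; exact (h_row ω).transpose) hz
  have hAv : ∀ j : Fin N, ∀ x ∉ Set.range (Subtype.val : Up n j → Idx n), ∀ y : Up n j,
      Aᵀ x y = 0 := fun j x hx y => hA _ _ (y.2.trans_lt (notMem_range_val_up hx))
  have hCv : ∀ j : Fin N, ∀ x ∉ Set.range (Subtype.val : Up n j → Idx n), ∀ y : Up p j,
      Cᵀ x y = 0 := fun j x hx y => hC _ _ (y.2.trans_lt (notMem_range_val_up hx))
  have hsub : ∀ j, Stabilizable (uu A j)ᵀ (uu C j)ᵀ := fun j =>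
    ⟨(uu L₀ j)ᵀ, IsHurwitz.submatrix (A := Aᵀ) (B := Cᵀ) (K := L₀ᵀ) Subtype.val_injective
      Subtype.val_injective (hAv j) (hCv j)
      (fun x hx y => hL₀ _ _ (y.2.trans_lt (notMem_range_val_up hx)))
      (isHurwitz_observer_iff.1 hL₀')⟩
  have hbase : ∀ i : Fin N, (i : ℕ) + 1 = N → IsHurwitz (uu A i + uu K₁ᵀ i * uu C i) := by
    -- The range `↑i` is everything when `i` is the last block.
    intro i hi
    have hK₁ : ∀ x ∉ Set.range (Subtype.val : Up p i → Idx p), ∀ y : Up n i, K₁ x y = 0 := by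
      intro x hx y
      have := Fin.lt_def.1 (notMem_range_val_up hx)
      omega
    exact isHurwitz_observer_iff.2 (IsHurwitz.submatrix (A := Aᵀ) (B := Cᵀ) (K := K₁)
      Subtype.val_injective Subtype.val_injective (hAv i) (hCv i) hK₁ h₁.2.2.1)
  have hstep : ∀ (i j : Fin N) (hij : (i : ℕ) + 1 = (j : ℕ)) (L : Matrix (Up n j) (Up p j) ℝ),
      IsHurwitz (uu A j + L * uu C j) → ∃ Y L', IsUniquePSDAREd (uu A i) (uu C i)
        (-(headRows (le_of_succ hij) L * upRows V j)) (upRows V i) Y L' := by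
    intro i j hij L hL
    obtain ⟨X, K, h⟩ := exists_isUniquePSDAREp_submatrix (A := (uu A j)ᵀ) (B := (uu C j)ᵀ)
      (H := (upRows V j)ᵀ) (K := Lᵀ)
      (f := Up.incl (le_of_succ hij)) (g := Up.incl (le_of_succ hij))
      (Up.incl_injective _) (Up.incl_injective _)
      (fun x hx y => hA _ _ (lt_of_le_of_lt y.2 (notMem_range_incl_up _ hx)))
      (fun x hx y => hC _ _ (lt_of_le_of_lt y.2 (notMem_range_incl_up _ hx)))
      (hV'.submatrix Subtype.val_injective) (isHurwitz_observer_iff.1 hL) (hsub i)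
    have h' : IsUniquePSDAREp (uu A i)ᵀ (uu C i)ᵀ
        (-(headRows (le_of_succ hij) L * upRows V j))ᵀ (upRows V i)ᵀ X K := by
      rw [Matrix.transpose_neg, Matrix.transpose_mul]
      exact h
    exact ⟨X, Kᵀ, h'.dual⟩
  obtain ⟨t, ht0, ht⟩ := exists_seq_fin_rev
    (T := fun i => Matrix (Up n i) (Up n i) ℝ × Matrix (Up n i) (Up p i) ℝ)
    (P := fun i t => IsHurwitz (uu A i + t.2 * uu C i))
    (Q := fun i t => t.1 = uu Y₁ i ∧ t.2 = uu K₁ᵀ i)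
    (R := fun i j t t' => ∀ hij : (i : ℕ) + 1 = (j : ℕ), IsUniquePSDAREd (uu A i) (uu C i)
      (-(headRows (le_of_succ hij) t'.2 * upRows V j)) (upRows V i) t.1 t.2)
    (fun i hi => ⟨(uu Y₁ i, uu K₁ᵀ i), hbase i hi, rfl, rfl⟩)
    (fun i j hij t ht => by
      obtain ⟨Y, L, h⟩ := hstep i j hij t.2 ht
      exact ⟨(Y, L), h.2.2.1, fun _ => h⟩)
  exact ⟨Y₁, K₁ᵀ, fun i => (t i).1, fun i => (t i).2, h₁.dual, ht0,
    fun i j hij => ht i j hij hij⟩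

end Recursion

end TriangularLQG

theorem proposition1 {N q r : ℕ} (n m p : Fin N → ℕ)
    (A : Matrix (Idx n) (Idx n) ℝ) (B : Matrix (Idx n) (Idx m) ℝ)
    (C : Matrix (Idx p) (Idx n) ℝ)
    (F : Matrix (Fin q) (Idx n) ℝ) (H : Matrix (Fin q) (Idx m) ℝ)
    (W : Matrix (Idx n) (Fin r) ℝ) (V : Matrix (Idx p) (Fin r) ℝ)
    (hA : IsLBT A) (hB : IsLBT B) (hC : IsLBT C)
    (h_stab : ∀ i, Stabilizable (diagBlock A i) (diagBlock B i))
    (hH : FullColRank H)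
    (h_col : ∀ ω : ℝ, FullColRank (pencil A B F H ω))
    (h_det : ∀ i, Detectable (diagBlock C i) (diagBlock A i))
    (hV : FullRowRank V)
    (h_row : ∀ ω : ℝ, FullRowRank (pencil A W C V ω)) :
    (∃ (X₁ : Matrix (Idx n) (Idx n) ℝ) (K₁ : Matrix (Idx m) (Idx n) ℝ)
        (X : ∀ i : Fin N, Matrix (Down n i) (Down n i) ℝ)
        (K : ∀ i : Fin N, Matrix (Down m i) (Down n i) ℝ),
      IsTheStabilizingAREp A B F H X₁ K₁ ∧
      (∀ i : Fin N, (i : ℕ) = 0 → X i = dd X₁ i ∧ K i = dd K₁ i) ∧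
      (∀ (i j : Fin N) (hij : (i : ℕ) + 1 = (j : ℕ)),
        IsUniquePSDAREp (dd A j) (dd B j)
          (-(downCols H i * tailCols (le_of_succ hij) (K i))) (downCols H j)
          (X j) (K j))) ∧
    (∃ (Y_N : Matrix (Idx n) (Idx n) ℝ) (L_N : Matrix (Idx n) (Idx p) ℝ)
        (Y : ∀ i : Fin N, Matrix (Up n i) (Up n i) ℝ)
        (L : ∀ i : Fin N, Matrix (Up n i) (Up p i) ℝ),
      IsTheStabilizingAREd A C W V Y_N L_N ∧
      (∀ i : Fin N, (i : ℕ) + 1 = N → Y i = uu Y_N i ∧ L i = uu L_N i) ∧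
      (∀ (i j : Fin N) (hij : (i : ℕ) + 1 = (j : ℕ)),
        IsUniquePSDAREd (uu A i) (uu C i)
          (-(headRows (le_of_succ hij) (L j) * upRows V j)) (upRows V i)
          (Y i) (L i))) := by
  exact ⟨exists_control_recursion hA hB h_stab hH h_col,
    exists_filter_recursion hA hC h_det hV h_row⟩
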